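/- Throughout, $\log$ is the binary logarithm, and for a set $A\subseteq\{0,1\}^*$ of binary strings put $A_n=A\cap\{0,1\}^n$. For functions $k=k(n)\in\mathbb N$ and $\beta=\beta(n)>0$, the set $A$ is called \emph{$(k,\beta)$-wise independent} if for all sufficiently large $n$ the set $A_n$ is nonempty and, for every $S\subseteq\{1,\dots,n\}$ with $|S|\le k(n)$ and every $\mathbf c\in\{0,1\}^n$, $$\left|\frac{|\{\mathbf a\in A_n : a_i=c_i \text{ for all } i\in S\}|}{|A_n|}-\frac1{2^{|S|}}\right|\le\beta(n).$$ The set $A$ is called \emph{$\varepsilon$-rich} if for all sufficiently large $n$ the following holds: for every $I\subseteq\{1,\dots,n\}$, every partition $\{R_1,\dots,R_r\}$ of $I$ ($r\ge 0$) with $\prod_{j=1}^r\bigl(1-2^{-|R_j|}\bigr)\ge\varepsilon$, every $Q\subseteq\{1,\dots,n\}\setminus I$ with $|Q|\le\log n$, and every $\mathbf c\in\{0,1\}^n$, there is $\mathbf a\in A_n$ such that $a_i=c_i$ for all $i\in Q$, and for every $j\in\{1,\dots,r\}$ there is $i\in R_j$ with $a_i\ne c_i$. A \emph{read-once conjunction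 of a DNF and a CNF} in $n$ variables is a formula $$\Bigl(\bigvee_{j=1}^q\bigwedge_{i\in Q_j}\ell(x_i)\Bigr)\wedge\bigwedge_{j=1}^r\bigvee_{i\in R_j}\lnot\ell(x_i)$$ with $q,r\ge 0$, pairwise disjoint sets $Q_1,\dots,Q_q,R_1,\dots,R_r\subseteq\{1,\dots,n\}$, and $\ell(x_i)\in\{x_i,\lnot x_i\}$ for each $i$; for $q=0$ the DNF is absent and the formula is the CNF alone. The set $A$ is an \emph{$\varepsilon$-hitting set} for such formulas if for all sufficiently large $n$, every such formula in $n$ variables that is satisfied by at least $\varepsilon 2^n$ of the inputs in $\{0,1\}^n$ is satisfied by some $\mathbf a\in A_n$. \textbf{Theorem.} Let $\varepsilon>0$, let $C$ be the least odd integer greater than $\bigl(\frac2\varepsilon\ln\frac1\varepsilon\bigr)^2$, and let $\beta=\beta(n)$ satisfy $0<\beta(n)<\frac1{n^{C+3}}$ for all sufficiently large $n$. Then every $(\lceil(C+2)\log n\rceil,\beta)$-wise independent set $A\subseteq\{0,1\}^*$ is $\varepsilon$-rich. Consequently, every such set is an $\varepsilon$-hitting set for read-once conjunctions of a DNF and a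 CNF. -/

import Mathlib

open Filter

namespace Richness

/-- `𝒜ₙ = 𝒜 ∩ {0,1}ⁿ`, the strings of length `n` of a set `𝒜 ⊆ {0,1}*`, read as functions
on the bit positions. -/
def slice (A : Set (List Bool)) (n : ℕ) : Set (Fin n → Bool) :=
  {a | List.ofFn a ∈ A}

/-- `𝒜ₙ^S(c)`: the strings of `𝒜ₙ` that coincide with `c` on the positions in `S`. -/
def agreeing (A : Set (List Bool)) {n : ℕ} (S : Finset (Fin n)) (c : Fin n → Bool) :
    Set (Fin n → Bool) :=
  {a ∈ slice A n | ∀ i ∈ S, a i = c i}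

/-- `A` is `(k, β)`-wise independent, where `k` and `β` may depend on the length `n`:
for all sufficiently large `n`, a uniformly random element of `𝒜ₙ` (which is nonempty) has on every
set `S` of at most `k` positions a distribution that is pointwise `β`-close to uniform. -/
def IsAlmostWiseIndependent (k : ℕ → ℕ) (β : ℕ → ℝ) (A : Set (List Bool)) : Prop :=
  ∀ᶠ n : ℕ in atTop, (slice A n).Nonempty ∧
    ∀ S : Finset (Fin n), S.card ≤ k n → ∀ c : Fin n → Bool,
      |((agreeing A S c).ncard : ℝ) / ((slice A n).ncard : ℝ) - 1 / 2 ^ S.card| ≤ β n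

/-- `A` is `ε`-rich. -/
def IsRich (ε : ℝ) (A : Set (List Bool)) : Prop :=
  ∀ᶠ n : ℕ in atTop, ∀ (I : Finset (Fin n)) (P : Finpartition I),
    ε ≤ ∏ R ∈ P.parts, (1 - 1 / (2 : ℝ) ^ R.card) →
    ∀ Q : Finset (Fin n), Disjoint Q I → (Q.card : ℝ) ≤ Real.logb 2 n →
    ∀ c : Fin n → Bool, ∃ a ∈ slice A n,
      (∀ i ∈ Q, a i = c i) ∧ ∀ R ∈ P.parts, ∃ i ∈ R, a i ≠ c i

/-- A read-once conjunction of a DNF and a CNF in the variables `x₁, …, xₙ`,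
`(⋁ⱼ ⋀_{i ∈ Qⱼ} ℓ(xᵢ)) ∧ ⋀ⱼ ⋁_{i ∈ Rⱼ} ¬ ℓ(xᵢ)`,
where `ℓ(xᵢ)` is `xᵢ` if `cᵢ = 1` and `¬ xᵢ` if `cᵢ = 0`. No variable occurs in two of the
sets `Qⱼ`, `Rⱼ`, so the choice of `c` gives every occurring variable an arbitrary sign. -/
structure ReadOnceDNFCNF (n : ℕ) where
  /-- number of terms of the DNF -/
  q : ℕ
  /-- number of clauses of the CNF -/
  r : ℕ
  /-- variables of the terms -/
  Q : Fin q → Finset (Fin n)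
  /-- variables of the clauses -/
  R : Fin r → Finset (Fin n)
  /-- signs of the literals -/
  c : Fin n → Bool
  disjoint_QQ : ∀ j j', j ≠ j' → Disjoint (Q j) (Q j')
  disjoint_RR : ∀ j j', j ≠ j' → Disjoint (R j) (R j')
  disjoint_QR : ∀ j j', Disjoint (Q j) (R j')

/-- The formula is true under the assignment `a`. For `q = 0` the DNF is absent, and the formula
is just the CNF. -/
def ReadOnceDNFCNF.Accepts {n : ℕ} (F : ReadOnceDNFCNF n) (a : Fin n → Bool) : Prop :=
  (F.q = 0 ∨ ∃ j, ∀ i ∈ F.Q j, a i = F.c i) ∧ ∀ j, ∃ i ∈ F.R j, a i ≠ F.c i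

/-- `A` is an `ε`-hitting set for read-once conjunctions of a DNF and a CNF: for all sufficiently
large `n`, every such formula in `n` variables that accepts at least an `ε` fraction of all inputs
accepts some element of `𝒜ₙ`. -/
def IsHittingSetForReadOnceDNFCNF (ε : ℝ) (A : Set (List Bool)) : Prop :=
  ∀ᶠ n : ℕ in atTop, ∀ F : ReadOnceDNFCNF n,
    ε ≤ ({a | F.Accepts a}.ncard : ℝ) / 2 ^ n → ∃ a ∈ slice A n, F.Accepts a

end Richness

/-!
Given pairwise disjoint sets `R j` with `∏ (1 - 2 ^ (-#(R j))) ≥ ε` and a set `Q` of at most `log n`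
positions, it suffices that the product `[a = c on Q] * ∏ (1 - [a = c on R j])` has positive average
over `a ∈ 𝒜ₙ`. There are at most `n / log n` sets `R j` of size greater than `log n`, and each of
them lowers the average by at most about `2 ^ (-#Q) / n`, so together they are negligible. For the
remaining ones the product is bounded below by its inclusion-exclusion expansion cut off before the
even degree `C + 1` (Bonferroni). Each of its polynomially many monomials involves at most
`(C + 1) * log n` positions, so almost independence replaces its average by the uniform one, and the
uniform value of the truncated expansion is at least `ε` minus the elementary symmetric polynomial
of degree `C + 1` in the `2 ^ (-#(R j))`. As `∑ 2 ^ (-#(R j)) ≤ log (1 / ε)`, the latter is at most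
`log (1 / ε) ^ (C + 1) / (C + 1)!`, which the choice of `C` makes smaller than `ε`.

A conjunction of a DNF and a CNF satisfied by an `ε` fraction of the inputs has a term with at most
`log n` literals, as otherwise the DNF would be satisfied only with probability `O(1 / log n)`;
richness applied to this term and to the clauses gives a satisfying element of `𝒜ₙ`.
-/

namespace Richness

open Finset
open scoped BigOperators Nat Topology

section TruncatedProd

variable {ι R : Type*}

/-- The expansion `∑ J ⊆ s, (-1) ^ #J * ∏ i ∈ J, p i` of `∏ i ∈ s, (1 - p i)`, cut off before
degree `k`; by Bonferroni it bounds the product from below for even `k`. -/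
def truncatedProd [CommRing R] (k : ℕ) (s : Finset ι) (p : ι → R) : R :=
  ∑ J ∈ s.powerset with #J < k, (-1) ^ #J * ∏ i ∈ J, p i

section CommRing

variable [CommRing R]

lemma truncatedProd_zero (s : Finset ι) (p : ι → R) : truncatedProd 0 s p = 0 := by
  simp [truncatedProd]

lemma truncatedProd_empty {k : ℕ} (hk : k ≠ 0) (p : ι → R) : truncatedProd k ∅ p = 1 := by
  simp [truncatedProd, sum_filter, Nat.pos_iff_ne_zero, hk]

lemma truncatedProd_succ (k : ℕ) (s : Finset ι) (p : ι → R) :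
    truncatedProd (k + 1) s p =
      truncatedProd k s p + (-1) ^ k * ∑ J ∈ s.powersetCard k, ∏ i ∈ J, p i := by
  classical
  have hsplit : {J ∈ s.powerset | #J < k + 1} = {J ∈ s.powerset | #J < k} ∪ s.powersetCard k := by
    ext J
    simp only [mem_filter, mem_union, mem_powerset, mem_powersetCard]
    grind
  have hdisj : Disjoint {J ∈ s.powerset | #J < k} (s.powersetCard k) :=
    disjoint_left.2 fun J hJ hJ' => (mem_filter.1 hJ).2.ne (mem_powersetCard.1 hJ').2
  rw [truncatedProd, hsplit, sum_union hdisj, mul_sum, truncatedProd]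
  congr 1
  exact sum_congr rfl fun J hJ => by rw [(mem_powersetCard.1 hJ).2]

lemma truncatedProd_succ_insert [DecidableEq ι] {s : Finset ι} {x : ι} (hx : x ∉ s)
    (k : ℕ) (p : ι → R) :
    truncatedProd (k + 1) (insert x s) p =
      truncatedProd (k + 1) s p - p x * truncatedProd k s p := by
  simp only [truncatedProd, sum_filter, sum_powerset_insert hx, sub_eq_add_neg, mul_sum,
    ← sum_neg_distrib]
  congr 1
  refine sum_congr rfl fun J hJ => ?_
  have hxJ : x ∉ J := fun h => hx (mem_powerset.1 hJ h)
  simp only [card_insert_of_notMem hxJ, prod_insert hxJ, Nat.add_lt_add_iff_right]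
  split_ifs <;> ring

end CommRing

variable [CommRing R] [LinearOrder R] [IsStrictOrderedRing R] {s : Finset ι} {p : ι → R}

theorem bonferroni (h₀ : ∀ i ∈ s, 0 ≤ p i) (h₁ : ∀ i ∈ s, p i ≤ 1) (k : ℕ) :
    0 ≤ (-1) ^ k * (∏ i ∈ s, (1 - p i) - truncatedProd k s p) := by
  classical
  induction s using Finset.induction_on generalizing k with
  | empty =>
    obtain rfl | hk := eq_or_ne k 0
    · simp [truncatedProd_zero]
    · simp [truncatedProd_empty hk]
  | insert x s hx ih =>
    rw [forall_mem_insert] at h₀ h₁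
    cases k with
    | zero =>
      rw [truncatedProd_zero, pow_zero, one_mul, sub_zero, prod_insert hx]
      exact mul_nonneg (sub_nonneg.2 h₁.1) (prod_nonneg fun i hi => sub_nonneg.2 (h₁.2 i hi))
    | succ k =>
      have hx_term := mul_nonneg h₀.1 (ih h₀.2 h₁.2 k)
      have hs_term := ih h₀.2 h₁.2 (k + 1)
      rw [prod_insert hx, truncatedProd_succ_insert hx]
      rw [pow_succ] at hs_term ⊢
      linarith

lemma truncatedProd_le_prod_one_sub {k : ℕ} (hk : Even k) (h₀ : ∀ i ∈ s, 0 ≤ p i)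
    (h₁ : ∀ i ∈ s, p i ≤ 1) : truncatedProd k s p ≤ ∏ i ∈ s, (1 - p i) := by
  simpa [hk.neg_one_pow] using bonferroni h₀ h₁ k

lemma prod_one_sub_le_truncatedProd_add {k : ℕ} (hk : Even k) (h₀ : ∀ i ∈ s, 0 ≤ p i)
    (h₁ : ∀ i ∈ s, p i ≤ 1) :
    ∏ i ∈ s, (1 - p i) ≤ truncatedProd k s p + ∑ J ∈ s.powersetCard k, ∏ i ∈ J, p i := by
  simpa [truncatedProd_succ, pow_succ, hk.neg_one_pow] using bonferroni h₀ h₁ (k + 1)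

lemma one_sub_sum_le_prod_one_sub (h₀ : ∀ i ∈ s, 0 ≤ p i) (h₁ : ∀ i ∈ s, p i ≤ 1) :
    1 - ∑ i ∈ s, p i ≤ ∏ i ∈ s, (1 - p i) := by
  have htrunc : truncatedProd 2 s p = 1 - ∑ i ∈ s, p i := by
    simp [truncatedProd_succ 1, truncatedProd_succ 0, truncatedProd_zero, powersetCard_one,
      sub_eq_add_neg]
  exact htrunc ▸ truncatedProd_le_prod_one_sub even_two h₀ h₁

lemma truncatedProd_filter_sub_sum_filter_not_le (P : ι → Prop) [DecidablePred P] {k : ℕ}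
    (hk : Even k) (h₀ : ∀ i ∈ s, 0 ≤ p i) (h₁ : ∀ i ∈ s, p i ≤ 1) :
    truncatedProd k {i ∈ s | P i} p - ∑ i ∈ s with ¬ P i, p i ≤ ∏ i ∈ s, (1 - p i) := by
  have htrunc := truncatedProd_le_prod_one_sub hk (fun i hi => h₀ i (mem_of_mem_filter i hi))
    fun i hi => h₁ i (mem_of_mem_filter (p := P) i hi)
  have hunion := one_sub_sum_le_prod_one_sub (fun i hi => h₀ i (mem_of_mem_filter i hi))
    fun i hi => h₁ i (mem_of_mem_filter (p := (¬ P ·)) i hi)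
  have hsum : 0 ≤ ∑ i ∈ s with ¬ P i, p i := sum_nonneg fun i hi => h₀ i (mem_of_mem_filter i hi)
  have hprod : 0 ≤ ∏ i ∈ s with P i, (1 - p i) :=
    prod_nonneg fun i hi => sub_nonneg.2 (h₁ i (mem_of_mem_filter i hi))
  have hprod' : ∏ i ∈ s with P i, (1 - p i) ≤ 1 :=
    prod_le_one (fun i hi => sub_nonneg.2 (h₁ i (mem_of_mem_filter i hi)))
      fun i hi => sub_le_self _ (h₀ i (mem_of_mem_filter i hi))
  rw [← prod_filter_mul_prod_filter_not s P]
  linarith [mul_le_mul_of_nonneg_left hunion hprod, mul_le_of_le_one_left hsum hprod']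

end TruncatedProd

lemma sum_powersetCard_succ_insert {ι R : Type*} [CommSemiring R] [DecidableEq ι] {s : Finset ι}
    {x : ι} (hx : x ∉ s) (p : ι → R) (m : ℕ) :
    ∑ J ∈ (insert x s).powersetCard (m + 1), ∏ i ∈ J, p i =
      (∑ J ∈ s.powersetCard (m + 1), ∏ i ∈ J, p i) +
        p x * ∑ J ∈ s.powersetCard m, ∏ i ∈ J, p i := by
  simp only [powersetCard_eq_filter, sum_filter, sum_powerset_insert hx, mul_sum]
  congr 1
  refine sum_congr rfl fun J hJ => ?_
  have hxJ : x ∉ J := fun h => hx (mem_powerset.1 hJ h)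
  simp only [card_insert_of_notMem hxJ, prod_insert hxJ, Nat.add_right_cancel_iff, mul_ite,
    mul_zero]

lemma factorial_mul_sum_powersetCard_prod_le {ι R : Type*} [CommRing R] [LinearOrder R]
    [IsStrictOrderedRing R] {s : Finset ι} {p : ι → R} (h₀ : ∀ i ∈ s, 0 ≤ p i) (m : ℕ) :
    (m ! : R) * ∑ J ∈ s.powersetCard m, ∏ i ∈ J, p i ≤ (∑ i ∈ s, p i) ^ m := by
  classical
  induction s using Finset.induction_on generalizing m with
  | empty =>
    cases m with
    | zero => simp
    | succ m => simp [powersetCard_eq_empty.2 (card_empty.trans_lt m.succ_pos)]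
  | insert x s hx ih =>
    rw [forall_mem_insert] at h₀
    cases m with
    | zero => simp
    | succ m =>
      rw [sum_powersetCard_succ_insert hx, sum_insert hx, mul_add, add_comm (p x)]
      calc _ = ((m + 1)! : R) * ∑ J ∈ s.powersetCard (m + 1), ∏ i ∈ J, p i +
              (m + 1 : ℕ) * (m ! * ∑ J ∈ s.powersetCard m, ∏ i ∈ J, p i) * p x := by
            rw [Nat.factorial_succ, Nat.cast_mul]; ring
        _ ≤ (∑ i ∈ s, p i) ^ (m + 1) + (m + 1 : ℕ) * (∑ i ∈ s, p i) ^ m * p x := by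
            gcongr
            exacts [ih h₀.2 _, h₀.1, ih h₀.2 _]
        _ ≤ (∑ i ∈ s, p i + p x) ^ (m + 1) :=
            pow_add_mul_le_add_pow (sum_nonneg h₀.2) (by linarith [sum_nonneg h₀.2, h₀.1]) _

section RealProducts

variable {ι : Type*} {s : Finset ι} {p : ι → ℝ} {ε : ℝ}

lemma sum_le_log_one_div_of_le_prod_one_sub (hε : 0 < ε) (h₁ : ∀ i ∈ s, p i ≤ 1)
    (h : ε ≤ ∏ i ∈ s, (1 - p i)) : ∑ i ∈ s, p i ≤ Real.log (1 / ε) := by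
  have hexp : ε ≤ Real.exp (-∑ i ∈ s, p i) := calc
    ε ≤ ∏ i ∈ s, (1 - p i) := h
    _ ≤ ∏ i ∈ s, Real.exp (-p i) :=
      prod_le_prod (fun i hi => sub_nonneg.2 (h₁ i hi)) fun i _ => Real.one_sub_le_exp_neg _
    _ = Real.exp (-∑ i ∈ s, p i) := by rw [← Real.exp_sum, sum_neg_distrib]
  rw [one_div, Real.log_inv]
  linarith [(Real.log_le_iff_le_exp hε).2 hexp]

lemma sub_log_pow_div_factorial_le_truncatedProd (hε : 0 < ε) {k : ℕ} (hk : Even k)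
    (h₀ : ∀ i ∈ s, 0 ≤ p i) (h₁ : ∀ i ∈ s, p i ≤ 1) (h : ε ≤ ∏ i ∈ s, (1 - p i)) :
    ε - Real.log (1 / ε) ^ k / k ! ≤ truncatedProd k s p := by
  have htail : ∑ J ∈ s.powersetCard k, ∏ i ∈ J, p i ≤ Real.log (1 / ε) ^ k / k ! := by
    rw [le_div_iff₀' (by positivity)]
    exact (factorial_mul_sum_powersetCard_prod_le h₀ k).trans <|
      pow_le_pow_left₀ (sum_nonneg h₀) (sum_le_log_one_div_of_le_prod_one_sub hε h₁ h) k
  linarith [prod_one_sub_le_truncatedProd_add hk h₀ h₁]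

end RealProducts

lemma card_powerset_filter_card_lt_le {ι : Type*} (s : Finset ι) {k n : ℕ} (hs : #s ≤ n)
    (hn : n ≠ 0) : #{J ∈ s.powerset | #J < k + 1} ≤ (k + 1) * n ^ k := by
  classical
  have hunion : {J ∈ s.powerset | #J < k + 1} = (range (k + 1)).biUnion s.powersetCard := by
    ext J
    simp only [mem_filter, mem_biUnion, mem_powerset, mem_powersetCard, mem_range]
    exact ⟨fun h => ⟨#J, h.2, h.1, rfl⟩, by rintro ⟨m, hm, h, rfl⟩; exact ⟨h, hm⟩⟩
  calc #{J ∈ s.powerset | #J < k + 1}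
      ≤ #(range (k + 1)) * n ^ k := by
        rw [hunion]
        refine card_biUnion_le_card_mul _ _ _ fun m hm => ?_
        calc #(s.powersetCard m) = (#s).choose m := card_powersetCard m s
          _ ≤ #s ^ m := Nat.choose_le_pow _ _
          _ ≤ n ^ m := Nat.pow_le_pow_left hs m
          _ ≤ n ^ k := Nat.pow_le_pow_right hn.bot_lt (mem_range_succ_iff.1 hm)
    _ = (k + 1) * n ^ k := by rw [card_range]

lemma two_pow_mul_card_powerset_add_card_le {ι : Type*} {s t : Finset ι} {m k n : ℕ}
    (hm : m ≤ Nat.log 2 n) (hs : #s ≤ n) (ht : #t ≤ n) (hn : n ≠ 0) (hk : k ≠ 0) :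
    2 ^ m * (#{J ∈ s.powerset | #J < k + 1} + #t) ≤ (k + 2) * n ^ (k + 1) := calc
  _ ≤ n * ((k + 1) * n ^ k + n ^ k) :=
    Nat.mul_le_mul ((Nat.pow_le_pow_right two_pos hm).trans (Nat.pow_log_le_self 2 hn)) <|
      add_le_add (card_powerset_filter_card_lt_le s hs hn) (ht.trans (Nat.le_self_pow hk n))
  _ = (k + 2) * n ^ (k + 1) := by ring

section Indicators

variable {ι κ : Type*}

lemma one_div_two_pow_le_one (m : ℕ) : 1 / (2 : ℝ) ^ m ≤ 1 :=
  div_le_one_of_le₀ (one_le_pow₀ one_le_two) (by positivity)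

/-- The indicator of the event that a string `a` coincides with `c` on the positions in `S`; as a
real-valued function, so that probabilities of such events are averages `𝔼 a ∈ B, agreeInd c S a`
and `1 - agreeInd c S a` is the indicator of a clause. -/
noncomputable def agreeInd (c : ι → Bool) (S : Finset ι) (a : ι → Bool) : ℝ :=
  if ∀ i ∈ S, a i = c i then 1 else 0

variable {c : ι → Bool}

lemma agreeInd_of_agree {S : Finset ι} {a : ι → Bool} (h : ∀ i ∈ S, a i = c i) :
    agreeInd c S a = 1 :=
  if_pos h

lemma expect_agreeInd_eq_card_div (B : Finset (ι → Bool)) (S : Finset ι) :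
    𝔼 a ∈ B, agreeInd c S a = (#{a ∈ B | ∀ i ∈ S, a i = c i} : ℝ) / #B := by
  rw [expect_eq_sum_div_card]
  exact congrArg (· / (#B : ℝ)) (sum_boole _ _)

lemma agreeInd_eq_zero_iff {S : Finset ι} {a : ι → Bool} :
    agreeInd c S a = 0 ↔ ∃ i ∈ S, a i ≠ c i := by
  simp [agreeInd]

lemma agreeInd_nonneg (S : Finset ι) (a : ι → Bool) : 0 ≤ agreeInd c S a := by
  unfold agreeInd; split_ifs <;> norm_num

lemma agreeInd_le_one (S : Finset ι) (a : ι → Bool) : agreeInd c S a ≤ 1 := by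
  unfold agreeInd; split_ifs <;> norm_num

lemma agreeInd_anti {S T : Finset ι} (h : S ⊆ T) (a : ι → Bool) :
    agreeInd c T a ≤ agreeInd c S a := by
  by_cases hT : ∀ i ∈ T, a i = c i
  · rw [agreeInd_of_agree hT, agreeInd_of_agree fun i hi => hT i (h hi)]
  · rw [agreeInd, if_neg hT]
    exact agreeInd_nonneg S a

lemma prod_one_sub_agreeInd_nonneg (s : Finset κ) (R : κ → Finset ι) (a : ι → Bool) :
    0 ≤ ∏ j ∈ s, (1 - agreeInd c (R j) a) :=
  prod_nonneg fun _ _ => sub_nonneg.2 (agreeInd_le_one _ a)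

variable [DecidableEq ι]

lemma agreeInd_mul_prod (Q : Finset ι) (J : Finset κ) (R : κ → Finset ι) (a : ι → Bool) :
    agreeInd c Q a * ∏ j ∈ J, agreeInd c (R j) a = agreeInd c (Q ∪ J.biUnion R) a := by
  unfold agreeInd
  rw [prod_ite_zero, prod_const_one, ite_zero_mul_ite_zero, one_mul]
  refine if_congr ?_ rfl rfl
  simp only [mem_union, mem_biUnion]
  grind

lemma one_div_two_pow_mul_prod {Q : Finset ι} {J : Finset κ} {R : κ → Finset ι}
    (hR : (J : Set κ).PairwiseDisjoint R) (hQ : ∀ j ∈ J, Disjoint Q (R j)) :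
    1 / (2 : ℝ) ^ #Q * ∏ j ∈ J, 1 / (2 : ℝ) ^ #(R j) = 1 / 2 ^ #(Q ∪ J.biUnion R) := by
  rw [card_union_of_disjoint ((disjoint_biUnion_right _ _ _).2 hQ), card_biUnion hR, pow_add,
    ← prod_pow_eq_pow_sum, prod_div_distrib, prod_const_one, div_mul_div_comm, one_mul]

variable [Fintype ι]

lemma expect_agreeInd (c : ι → Bool) (S : Finset ι) :
    𝔼 a : ι → Bool, agreeInd c S a = 1 / 2 ^ #S := by
  calc 𝔼 a : ι → Bool, agreeInd c S a
      = 𝔼 a : ι → Bool, ∏ i, if i ∈ S then (if a i = c i then 1 else 0) else 1 := by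
        refine expect_congr rfl fun a _ => ?_
        rw [prod_ite_mem, univ_inter, prod_ite_zero, prod_const_one]
        rfl
    _ = (∏ i, ∑ b : Bool, if i ∈ S then (if b = c i then 1 else 0) else 1) /
          2 ^ Fintype.card ι := by
        rw [Fintype.expect_eq_sum_div_card, Fintype.prod_sum]
        simp
    _ = (∏ i, if i ∈ S then (1 / 2 : ℝ) else 1) := by
        rw [← card_univ, ← prod_const, ← prod_div_distrib]
        refine prod_congr rfl fun i _ => ?_
        split_ifs <;> simp
    _ = 1 / 2 ^ #S := by rw [prod_ite_mem, univ_inter, prod_const, one_div_pow]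

lemma expect_prod_one_sub_agreeInd {s : Finset κ} {R : κ → Finset ι}
    (hR : (s : Set κ).PairwiseDisjoint R) (c : ι → Bool) :
    𝔼 a : ι → Bool, ∏ j ∈ s, (1 - agreeInd c (R j) a) = ∏ j ∈ s, (1 - 1 / (2 : ℝ) ^ #(R j)) := by
  classical
  have hmonomial : ∀ J ∈ s.powerset, 𝔼 a : ι → Bool, ∏ j ∈ J, agreeInd c (R j) a =
      ∏ j ∈ J, 1 / (2 : ℝ) ^ #(R j) := fun J hJ => by
    have hJR := hR.subset (coe_subset.2 (mem_powerset.1 hJ))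
    have hcard := one_div_two_pow_mul_prod (Q := ∅) hJR fun _ _ => disjoint_empty_left _
    calc 𝔼 a : ι → Bool, ∏ j ∈ J, agreeInd c (R j) a
        = 𝔼 a : ι → Bool, agreeInd c (∅ ∪ J.biUnion R) a := by
          simp only [← agreeInd_mul_prod, agreeInd_of_agree (S := ∅) (by simp), one_mul]
      _ = ∏ j ∈ J, 1 / (2 : ℝ) ^ #(R j) := by
          rw [expect_agreeInd, ← hcard, card_empty, pow_zero, div_one, one_mul]
  simp only [prod_sub, prod_const_one, mul_one, expect_sum_comm, ← mul_expect]
  exact sum_congr rfl fun J hJ => by rw [hmonomial J hJ]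

end Indicators

lemma card_div_two_pow_log_succ_le {ι κ : Type*} [Fintype ι] {s : Finset κ} {R : κ → Finset ι}
    (hR : (s : Set κ).PairwiseDisjoint R)
    (hlarge : ∀ j ∈ s, Nat.log 2 (Fintype.card ι) < #(R j)) :
    (#s : ℝ) / 2 ^ (Nat.log 2 (Fintype.card ι) + 1) ≤
      1 / ((Nat.log 2 (Fintype.card ι) : ℝ) + 1) := by
  classical
  set l := Nat.log 2 (Fintype.card ι)
  have hcount : #s * (l + 1) ≤ 2 ^ (l + 1) := calc
    #s * (l + 1) ≤ ∑ j ∈ s, #(R j) := smul_eq_mul #s _ ▸ card_nsmul_le_sum _ _ _ hlarge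
    _ = #(s.biUnion R) := (card_biUnion hR).symm
    _ ≤ Fintype.card ι := card_le_univ _
    _ ≤ 2 ^ (l + 1) := (Nat.lt_pow_succ_log_self one_lt_two _).le
  rw [div_le_div_iff₀ (by positivity) (by positivity), one_mul]
  exact_mod_cast hcount

section AlmostIndependence

variable {ι κ : Type*}

/-- A uniformly random element of `B` is `β`-close to uniform on every set of at most `K` positions:
almost wise independence at a single length. An empty `B` is allowed, all its averages being `0`. -/
def IsAlmostIndependent (B : Finset (ι → Bool)) (K : ℕ) (β : ℝ) : Prop :=
  ∀ S : Finset ι, #S ≤ K → ∀ c : ι → Bool, |(𝔼 a ∈ B, agreeInd c S a) - 1 / 2 ^ #S| ≤ β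

namespace IsAlmostIndependent

variable {B : Finset (ι → Bool)} {K : ℕ} {β : ℝ}

lemma nonneg (hB : IsAlmostIndependent B K β) : 0 ≤ β :=
  (abs_nonneg _).trans (hB ∅ (by simp) fun _ => true)

variable {Q : Finset ι} {s : Finset κ} {R : κ → Finset ι} {k l : ℕ}

lemma abs_expect_mul_truncatedProd_sub_le (hB : IsAlmostIndependent B K β) (hK : k * l ≤ K)
    (hR : (s : Set κ).PairwiseDisjoint R) (hQR : ∀ j ∈ s, Disjoint Q (R j)) (hQ : #Q ≤ l)
    (hl : ∀ j ∈ s, #(R j) ≤ l) (c : ι → Bool) :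
    |(𝔼 a ∈ B, agreeInd c Q a * truncatedProd k s fun j => agreeInd c (R j) a) -
        1 / 2 ^ #Q * truncatedProd k s fun j => 1 / (2 : ℝ) ^ #(R j)| ≤
      #{J ∈ s.powerset | #J < k} * β := by
  classical
  have hmonomial : ∀ J ∈ {J ∈ s.powerset | #J < k},
      |(𝔼 a ∈ B, agreeInd c Q a * ∏ j ∈ J, agreeInd c (R j) a) -
        1 / 2 ^ #Q * ∏ j ∈ J, 1 / (2 : ℝ) ^ #(R j)| ≤ β := fun J hJ => by
    obtain ⟨hJs, hJk⟩ := mem_filter.1 hJ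
    rw [mem_powerset] at hJs
    have hcard : #(Q ∪ J.biUnion R) ≤ K := calc
      #(Q ∪ J.biUnion R) ≤ #Q + #(J.biUnion R) := card_union_le _ _
      _ ≤ l + #J * l := add_le_add hQ (card_biUnion_le_card_mul _ _ _ fun j hj => hl j (hJs hj))
      _ = (#J + 1) * l := by ring
      _ ≤ k * l := Nat.mul_le_mul_right _ hJk
      _ ≤ K := hK
    simp only [agreeInd_mul_prod]
    rw [one_div_two_pow_mul_prod (hR.subset (coe_subset.2 hJs)) fun j hj => hQR j (hJs hj)]
    exact hB _ hcard c
  have hexpand : (𝔼 a ∈ B, agreeInd c Q a * truncatedProd k s fun j => agreeInd c (R j) a) -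
      (1 / 2 ^ #Q * truncatedProd k s fun j => 1 / (2 : ℝ) ^ #(R j)) =
      ∑ J ∈ s.powerset with #J < k,
        (-1) ^ #J * ((𝔼 a ∈ B, agreeInd c Q a * ∏ j ∈ J, agreeInd c (R j) a) -
          1 / 2 ^ #Q * ∏ j ∈ J, 1 / (2 : ℝ) ^ #(R j)) := by
    simp only [truncatedProd, mul_sum, expect_sum_comm, mul_sub, sum_sub_distrib, mul_expect,
      mul_left_comm]
  rw [hexpand, ← nsmul_eq_mul]
  refine (abs_sum_le_sum_abs _ _).trans (sum_le_card_nsmul _ _ _ fun J hJ => ?_)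
  rw [abs_mul, abs_neg_one_pow, one_mul]
  exact hmonomial J hJ

lemma expect_mul_agreeInd_le (hB : IsAlmostIndependent B K β) {R : Finset ι} (hQR : Disjoint Q R)
    {m : ℕ} (hm : m ≤ #R) (hK : #Q + m ≤ K) (c : ι → Bool) :
    𝔼 a ∈ B, agreeInd c Q a * agreeInd c R a ≤ 1 / 2 ^ #Q * (1 / 2 ^ m) + β := by
  classical
  obtain ⟨T, hTR, rfl⟩ := exists_subset_card_eq hm
  have hcard : #(Q ∪ T) = #Q + #T := card_union_of_disjoint (hQR.mono_right hTR)
  calc 𝔼 a ∈ B, agreeInd c Q a * agreeInd c R a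
      ≤ 𝔼 a ∈ B, agreeInd c Q a * agreeInd c T a :=
        expect_le_expect fun a _ =>
          mul_le_mul_of_nonneg_left (agreeInd_anti hTR a) (agreeInd_nonneg Q a)
    _ = 𝔼 a ∈ B, agreeInd c (Q ∪ T) a :=
        expect_congr rfl fun a _ => by simpa using agreeInd_mul_prod Q {T} id a
    _ ≤ 1 / 2 ^ #(Q ∪ T) + β := by linarith [(abs_le.1 (hB _ (hcard.trans_le hK) c)).2]
    _ = 1 / 2 ^ #Q * (1 / 2 ^ #T) + β := by rw [hcard, pow_add, one_div_mul_one_div]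

lemma le_expect_mul_prod_one_sub (hB : IsAlmostIndependent B K β) (hk : Even k) (hK : k * l ≤ K)
    (hK' : 2 * l + 1 ≤ K) (hR : (s : Set κ).PairwiseDisjoint R)
    (hQR : ∀ j ∈ s, Disjoint Q (R j)) (hQ : #Q ≤ l) (c : ι → Bool) :
    1 / 2 ^ #Q * ((truncatedProd k {j ∈ s | #(R j) ≤ l} fun j => 1 / (2 : ℝ) ^ #(R j)) -
          #{j ∈ s | ¬ #(R j) ≤ l} / 2 ^ (l + 1)) -
        (#{J ∈ {j ∈ s | #(R j) ≤ l}.powerset | #J < k} + #{j ∈ s | ¬ #(R j) ≤ l}) * β ≤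
      𝔼 a ∈ B, agreeInd c Q a * ∏ j ∈ s, (1 - agreeInd c (R j) a) := by
  set small := {j ∈ s | #(R j) ≤ l}
  set large := {j ∈ s | ¬ #(R j) ≤ l}
  have hsmall := hB.abs_expect_mul_truncatedProd_sub_le (k := k) (s := small) hK
    (hR.subset (coe_subset.2 (filter_subset _ _))) (fun j hj => hQR j (mem_of_mem_filter j hj)) hQ
    (fun j hj => (mem_filter.1 hj).2) c
  have hlarge : ∑ j ∈ large, 𝔼 a ∈ B, agreeInd c Q a * agreeInd c (R j) a ≤
      1 / 2 ^ #Q * (#large / 2 ^ (l + 1)) + #large * β := by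
    refine (sum_le_card_nsmul _ _ (1 / 2 ^ #Q * (1 / 2 ^ (l + 1)) + β) fun j hj => ?_).trans_eq
      (by rw [nsmul_eq_mul]; ring)
    obtain ⟨hjs, hjl⟩ := mem_filter.1 hj
    exact hB.expect_mul_agreeInd_le (hQR j hjs) (not_le.1 hjl) (by lia) c
  calc _ ≤ (𝔼 a ∈ B, agreeInd c Q a * truncatedProd k small fun j => agreeInd c (R j) a) -
        ∑ j ∈ large, 𝔼 a ∈ B, agreeInd c Q a * agreeInd c (R j) a := by
        rw [mul_sub, add_mul]
        linarith [(abs_le.1 hsmall).1]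
    _ = 𝔼 a ∈ B, agreeInd c Q a *
          ((truncatedProd k small fun j => agreeInd c (R j) a) -
            ∑ j ∈ large, agreeInd c (R j) a) := by
        simp only [mul_sub, mul_sum, expect_sub_distrib, expect_sum_comm]
    _ ≤ _ := expect_le_expect fun a _ => mul_le_mul_of_nonneg_left
        (truncatedProd_filter_sub_sum_filter_not_le _ hk (fun j _ => agreeInd_nonneg _ a)
          fun j _ => agreeInd_le_one _ a) (agreeInd_nonneg Q a)

end IsAlmostIndependent

lemma nonempty_of_prod_one_sub_pos {s : Finset κ} {R : κ → Finset ι}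
    (h : 0 < ∏ j ∈ s, (1 - 1 / (2 : ℝ) ^ #(R j))) : ∀ j ∈ s, (R j).Nonempty := fun j hj => by
  rw [nonempty_iff_ne_empty]
  intro hempty
  exact h.ne' (prod_eq_zero hj (by simp [hempty]))

lemma agree_and_disagree_of_mul_prod_pos {c : ι → Bool} {Q : Finset ι} {s : Finset κ}
    {R : κ → Finset ι} {a : ι → Bool}
    (h : 0 < agreeInd c Q a * ∏ j ∈ s, (1 - agreeInd c (R j) a)) :
    (∀ i ∈ Q, a i = c i) ∧ ∀ j ∈ s, ∃ i ∈ R j, a i ≠ c i := by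
  constructor
  · by_contra! hQ
    rw [agreeInd_eq_zero_iff.2 hQ, zero_mul] at h
    exact h.false
  · by_contra! hR
    obtain ⟨j, hj, hagree⟩ := hR
    rw [prod_eq_zero hj (by rw [agreeInd_of_agree hagree, sub_self]), mul_zero] at h
    exact h.false

theorem IsAlmostIndependent.exists_agree_and_disagree [Fintype ι] [Nonempty ι]
    {B : Finset (ι → Bool)} {K C : ℕ} {β ε : ℝ} (hB : IsAlmostIndependent B K β) (hC : Odd C)
    (hε : 0 < ε) (hK : (C + 1) * Nat.log 2 (Fintype.card ι) < K)
    (hβ : (C + 2) * ((Fintype.card ι : ℝ) ^ (C + 1) * β) +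
      1 / ((Nat.log 2 (Fintype.card ι) : ℝ) + 1) < ε - Real.log (1 / ε) ^ (C + 1) / (C + 1)!)
    {s : Finset κ} {R : κ → Finset ι} (hR : (s : Set κ).PairwiseDisjoint R)
    (hprod : ε ≤ ∏ j ∈ s, (1 - 1 / (2 : ℝ) ^ #(R j))) {Q : Finset ι}
    (hQR : ∀ j ∈ s, Disjoint Q (R j)) (hQ : #Q ≤ Nat.log 2 (Fintype.card ι)) (c : ι → Bool) :
    ∃ a ∈ B, (∀ i ∈ Q, a i = c i) ∧ ∀ j ∈ s, ∃ i ∈ R j, a i ≠ c i := by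
  classical
  set n := Fintype.card ι
  set l := Nat.log 2 n
  have hK' : 2 * l + 1 ≤ K := (Nat.mul_le_mul_right l (by have := hC.pos; lia)).trans_lt hK
  set small := {j ∈ s | #(R j) ≤ l}
  set large := {j ∈ s | ¬ #(R j) ≤ l}
  set p : κ → ℝ := fun j => 1 / 2 ^ #(R j)
  have hp₀ : ∀ j, 0 ≤ p j := fun j => by positivity
  have hp₁ : ∀ j, p j ≤ 1 := fun j => one_div_two_pow_le_one _
  have hmain := hB.le_expect_mul_prod_one_sub hC.add_one hK.le hK' hR hQR hQ c
  have hsmall : ε - Real.log (1 / ε) ^ (C + 1) / (C + 1)! ≤ truncatedProd (C + 1) small p :=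
    sub_log_pow_div_factorial_le_truncatedProd hε hC.add_one (fun j _ => hp₀ j) (fun j _ => hp₁ j)
      (hprod.trans (prod_le_prod_of_subset_of_le_one (filter_subset _ _)
        (fun j _ => sub_nonneg.2 (hp₁ j)) fun j _ _ => sub_le_self _ (hp₀ j)))
  have hlarge : (#large : ℝ) / 2 ^ (l + 1) ≤ 1 / ((l : ℝ) + 1) :=
    card_div_two_pow_log_succ_le (hR.subset (coe_subset.2 (filter_subset _ _)))
      fun j hj => not_le.1 (mem_filter.1 hj).2
  have hs : #s ≤ n := (card_le_card_biUnion hR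
    (nonempty_of_prod_one_sub_pos (hε.trans_le hprod))).trans (card_le_univ _)
  have hcount := two_pow_mul_card_powerset_add_card_le hQ
    ((card_le_card (filter_subset _ s)).trans hs : #small ≤ n)
    ((card_le_card (filter_subset _ s)).trans hs : #large ≤ n) Fintype.card_ne_zero hC.pos.ne'
  have herror : 2 ^ #Q * ((#{J ∈ small.powerset | #J < C + 1} + #large) * β) ≤
      (C + 2) * ((n : ℝ) ^ (C + 1) * β) := by
    have hβ₀ := hB.nonneg
    calc _ = ((2 ^ #Q * (#{J ∈ small.powerset | #J < C + 1} + #large) : ℕ) : ℝ) * β := by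
          push_cast; ring
      _ ≤ (((C + 2) * n ^ (C + 1) : ℕ) : ℝ) * β := by gcongr
      _ = (C + 2) * ((n : ℝ) ^ (C + 1) * β) := by push_cast; ring
  have hpos : 0 < 𝔼 a ∈ B, agreeInd c Q a * ∏ j ∈ s, (1 - agreeInd c (R j) a) := by
    refine lt_of_lt_of_le ?_ hmain
    rw [one_div, sub_pos, lt_inv_mul_iff₀ (by positivity)]
    linarith
  obtain ⟨a, haB, ha⟩ := exists_lt_of_expect_lt_expect ((expect_const_zero B).trans_lt hpos)
  exact ⟨a, haB, agree_and_disagree_of_mul_prod_pos ha⟩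

end AlmostIndependence

lemma natCast_le_logb_iff {m n : ℕ} : (m : ℝ) ≤ Real.logb 2 n ↔ m ≤ Nat.log 2 n := by
  have hlog : 0 ≤ Real.logb 2 n :=
    div_nonneg (Real.log_natCast_nonneg n) (Real.log_nonneg one_le_two)
  rw [← Real.natFloor_logb_natCast 2 n, Nat.cast_ofNat, Nat.le_floor_iff hlog]

lemma tendsto_one_div_log_add_one :
    Tendsto (fun n : ℕ => 1 / ((Nat.log 2 n : ℝ) + 1)) atTop (𝓝 0) :=
  tendsto_one_div_add_atTop_nhds_zero_nat.comp <|
    tendsto_atTop_atTop.2 fun m => ⟨2 ^ m, fun _ hn => Nat.le_log_of_pow_le one_lt_two hn⟩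

lemma expect_agreeInd_slice (A : Set (List Bool)) {n : ℕ} (S : Finset (Fin n)) (c : Fin n → Bool) :
    𝔼 a ∈ (slice A n).toFinite.toFinset, agreeInd c S a =
      ((agreeing A S c).ncard : ℝ) / ((slice A n).ncard : ℝ) := by
  rw [expect_agreeInd_eq_card_div, ← Set.ncard_eq_toFinset_card, ← Set.ncard_coe_finset]
  congr 3
  ext a
  simp [agreeing]

lemma IsAlmostWiseIndependent.eventually_isAlmostIndependent {k : ℕ → ℕ} {β : ℕ → ℝ}
    {A : Set (List Bool)} (hA : IsAlmostWiseIndependent k β A) :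
    ∀ᶠ n in atTop, IsAlmostIndependent (slice A n).toFinite.toFinset (k n) (β n) :=
  hA.mono fun n hn S hS c => by
    rw [expect_agreeInd_slice]
    exact hn.2 S hS c

theorem IsAlmostWiseIndependent.isRich {ε : ℝ} (hε : 0 < ε) {C : ℕ} (hC : Odd C)
    (hlog : Real.log (1 / ε) ^ (C + 1) < ε * (C + 1)!) {k : ℕ → ℕ}
    (hk : ∀ᶠ n in atTop, (C + 1) * Nat.log 2 n < k n) {β : ℕ → ℝ}
    (hβ : Tendsto (fun n : ℕ => (n : ℝ) ^ (C + 1) * β n) atTop (𝓝 0)) {A : Set (List Bool)}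
    (hA : IsAlmostWiseIndependent k β A) : IsRich ε A := by
  have hgap : 0 < ε - Real.log (1 / ε) ^ (C + 1) / (C + 1)! := by
    rwa [sub_pos, div_lt_iff₀ (by positivity)]
  have herror : Tendsto (fun n : ℕ => (C + 2) * ((n : ℝ) ^ (C + 1) * β n) +
      1 / ((Nat.log 2 n : ℝ) + 1)) atTop (𝓝 0) := by
    simpa using (hβ.const_mul ((C : ℝ) + 2)).add tendsto_one_div_log_add_one
  filter_upwards [hA.eventually_isAlmostIndependent, hk, herror.eventually_lt_const hgap,
    eventually_ne_atTop 0] with n hB hK hsmall hn I P hP Q hQI hQ c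
  have : NeZero n := ⟨hn⟩
  obtain ⟨a, ha, hagree⟩ := hB.exists_agree_and_disagree hC hε (by rwa [Fintype.card_fin])
    (by rwa [Fintype.card_fin]) P.disjoint hP (fun R hR => hQI.mono_right (P.le hR))
    (by rwa [Fintype.card_fin, ← natCast_le_logb_iff]) c
  exact ⟨a, by simpa using ha, hagree⟩

lemma exists_finpartition_parts_eq_image {ι κ : Type*} [DecidableEq ι] {s : Finset κ}
    {R : κ → Finset ι} (hR : (s : Set κ).PairwiseDisjoint R) (hne : ∀ j ∈ s, (R j).Nonempty) :
    ∃ P : Finpartition (s.biUnion R), P.parts = s.image R :=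
  ⟨{ parts := s.image R
     supIndep := by
       classical exact .image (f := id) (supIndep_iff_pairwiseDisjoint.2 hR)
     sup_parts := by rw [sup_image, sup_eq_biUnion, Function.id_comp]
     bot_notMem := by simpa [eq_comm] using fun j hj => (hne j hj).ne_empty }, rfl⟩

lemma ncard_div_two_pow_le_expect {ι : Type*} [Fintype ι] [DecidableEq ι]
    {P : (ι → Bool) → Prop} {f : (ι → Bool) → ℝ} (hf : ∀ a, 0 ≤ f a)
    (hP : ∀ a, P a → 1 ≤ f a) : ({a | P a}.ncard : ℝ) / 2 ^ Fintype.card ι ≤ 𝔼 a, f a := by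
  classical
  rw [Fintype.expect_eq_sum_div_card, Fintype.card_fun, Fintype.card_bool,
    Set.ncard_eq_toFinset_card', Nat.cast_pow, Nat.cast_ofNat]
  gcongr
  calc (#{a | P a}.toFinset : ℝ) = ∑ a, if P a then 1 else 0 := by simp [sum_boole]
    _ ≤ ∑ a, f a := sum_le_sum fun a _ => by split_ifs with h; exacts [hP a h, hf a]

lemma exists_card_le_log_of_lt_sum {ι κ : Type*} [Fintype ι] {s : Finset κ} {Q : κ → Finset ι}
    (hQ : (s : Set κ).PairwiseDisjoint Q)
    (h : 1 / ((Nat.log 2 (Fintype.card ι) : ℝ) + 1) < ∑ j ∈ s, 1 / (2 : ℝ) ^ #(Q j)) :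
    ∃ j ∈ s, #(Q j) ≤ Nat.log 2 (Fintype.card ι) := by
  by_contra! hlarge
  refine h.not_ge ((sum_le_card_nsmul _ _ _ fun j hj => one_div_le_one_div_of_le (by positivity)
    (pow_le_pow_right₀ one_le_two (hlarge j hj))).trans ?_)
  simpa [div_eq_mul_inv] using card_div_two_pow_log_succ_le hQ hlarge

namespace ReadOnceDNFCNF

variable {n : ℕ} (F : ReadOnceDNFCNF n)

lemma ncard_accepts_div_le_prod :
    ({a | F.Accepts a}.ncard : ℝ) / 2 ^ n ≤ ∏ j, (1 - 1 / (2 : ℝ) ^ #(F.R j)) := by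
  have hR : ((univ : Finset (Fin F.r)) : Set (Fin F.r)).PairwiseDisjoint F.R :=
    fun j _ j' _ => F.disjoint_RR j j'
  rw [← expect_prod_one_sub_agreeInd hR F.c]
  simpa using ncard_div_two_pow_le_expect (prod_one_sub_agreeInd_nonneg univ F.R) fun a ha =>
    (prod_eq_one fun j _ => by rw [agreeInd_eq_zero_iff.2 (ha.2 j), sub_zero]).ge

lemma ncard_accepts_div_le_sum (hq : F.q ≠ 0) :
    ({a | F.Accepts a}.ncard : ℝ) / 2 ^ n ≤ ∑ j, 1 / (2 : ℝ) ^ #(F.Q j) := by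
  simp only [← expect_agreeInd F.c, ← expect_sum_comm]
  simpa using ncard_div_two_pow_le_expect
    (fun a => sum_nonneg fun j _ => agreeInd_nonneg (F.Q j) a) fun a ha => by
      obtain ⟨j, hj⟩ := ha.1.resolve_left hq
      rw [← agreeInd_of_agree hj]
      exact single_le_sum (f := fun j => agreeInd F.c (F.Q j) a)
        (fun j _ => agreeInd_nonneg _ a) (mem_univ j)

end ReadOnceDNFCNF

theorem IsRich.isHittingSetForReadOnceDNFCNF {ε : ℝ} (hε : 0 < ε) {A : Set (List Bool)}
    (hA : IsRich ε A) : IsHittingSetForReadOnceDNFCNF ε A := by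
  filter_upwards [hA, tendsto_one_div_log_add_one.eventually_lt_const hε] with n hrich hlog F hF
  have hprod := hF.trans F.ncard_accepts_div_le_prod
  have hR : ((univ : Finset (Fin F.r)) : Set (Fin F.r)).PairwiseDisjoint F.R :=
    fun j _ j' _ => F.disjoint_RR j j'
  have hne := nonempty_of_prod_one_sub_pos (hε.trans_le hprod)
  obtain ⟨P, hP⟩ := exists_finpartition_parts_eq_image hR hne
  have hprodP : ε ≤ ∏ R ∈ P.parts, (1 - 1 / (2 : ℝ) ^ #R) := by
    rwa [hP, prod_image fun j hj j' hj' h => hR.eq_of_le hj hj' (hne j hj).ne_empty h.le]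
  obtain hq | hq := eq_or_ne F.q 0
  · obtain ⟨a, ha, -, hclauses⟩ := hrich _ P hprodP ∅ (disjoint_empty_left _)
      (natCast_le_logb_iff.2 (by simp)) F.c
    exact ⟨a, ha, .inl hq, fun j => hclauses _ (hP ▸ mem_image_of_mem _ (mem_univ j))⟩
  · obtain ⟨j₀, -, hj₀⟩ := exists_card_le_log_of_lt_sum (s := univ) (Q := F.Q)
      (fun j _ j' _ => F.disjoint_QQ j j')
      ((by rwa [Fintype.card_fin] : _ < ε).trans_le (hF.trans (F.ncard_accepts_div_le_sum hq)))
    rw [Fintype.card_fin] at hj₀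
    obtain ⟨a, ha, hterm, hclauses⟩ := hrich _ P hprodP (F.Q j₀)
      ((disjoint_biUnion_right _ _ _).2 fun j _ => F.disjoint_QR j₀ j)
      (natCast_le_logb_iff.2 hj₀) F.c
    exact ⟨a, ha, .inr ⟨j₀, hterm⟩, fun j => hclauses _ (hP ▸ mem_image_of_mem _ (mem_univ j))⟩

section Parameters

variable {ε : ℝ} {C : ℕ}

lemma succ_pow_succ_le_factorial_two_mul (m : ℕ) : (m + 1) ^ (m + 1) ≤ (2 * m + 2)! := calc
  (m + 1) ^ (m + 1) ≤ (m + 1)! * (m + 1 + 1) ^ (m + 1) :=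
    (Nat.pow_le_pow_left m.succ.le_succ _).trans (Nat.le_mul_of_pos_left _ (Nat.factorial_pos _))
  _ ≤ (m + 1 + (m + 1))! := Nat.factorial_mul_pow_le_factorial
  _ = (2 * m + 2)! := by congr 1; ring

lemma log_pow_lt_mul_factorial_of_one_lt (hε : 1 < ε) {k : ℕ} (hk : Even k) :
    Real.log (1 / ε) ^ k < ε * k ! := by
  have hlog : 0 < Real.log ε := Real.log_pos hε
  rw [one_div, Real.log_inv, hk.neg_pow, ← div_lt_iff₀ (by positivity)]
  calc Real.log ε ^ k / k ! < ∑ i ∈ range (k + 2), Real.log ε ^ i / i ! :=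
        single_lt_sum (f := fun i => Real.log ε ^ i / (i ! : ℝ)) k.succ_ne_self
          (mem_range.2 (by lia)) (mem_range.2 (by lia)) (by positivity) fun _ _ _ => by positivity
    _ ≤ Real.exp (Real.log ε) := Real.sum_le_exp_of_nonneg hlog.le _
    _ = ε := Real.exp_log (by linarith)

lemma log_pow_lt_mul_factorial_of_le_one (hε : 0 < ε) (hε₁ : ε ≤ 1) (hC : Odd C)
    (h : (2 / ε * Real.log (1 / ε)) ^ 2 < C) :
    Real.log (1 / ε) ^ (C + 1) < ε * (C + 1)! := by
  obtain ⟨m, rfl⟩ := hC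
  have hsq : Real.log (1 / ε) ^ 2 < ε ^ 2 * (m + 1) := by
    have hclear : (2 / ε * Real.log (1 / ε)) ^ 2 = 4 * Real.log (1 / ε) ^ 2 / ε ^ 2 := by ring
    rw [hclear, div_lt_iff₀ (by positivity)] at h
    push_cast at h
    nlinarith [sq_pos_of_pos hε, mul_nonneg (sq_nonneg ε) (Nat.cast_nonneg (α := ℝ) m)]
  calc Real.log (1 / ε) ^ (2 * m + 1 + 1) = (Real.log (1 / ε) ^ 2) ^ (m + 1) := by
        rw [← pow_mul]; congr 1
    _ < (ε ^ 2 * (m + 1)) ^ (m + 1) := pow_lt_pow_left₀ hsq (sq_nonneg _) m.succ_ne_zero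
    _ = ε ^ (2 * (m + 1)) * (m + 1) ^ (m + 1) := by rw [mul_pow, ← pow_mul]
    _ ≤ ε * (2 * m + 1 + 1)! := by
        gcongr
        · exact pow_le_of_le_one hε.le hε₁ (by positivity)
        · exact_mod_cast succ_pow_succ_le_factorial_two_mul m

lemma log_pow_lt_mul_factorial (hε : 0 < ε) (hC : Odd C)
    (h : (2 / ε * Real.log (1 / ε)) ^ 2 < C) :
    Real.log (1 / ε) ^ (C + 1) < ε * (C + 1)! :=
  (le_or_gt ε 1).elim (log_pow_lt_mul_factorial_of_le_one hε · hC h)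
    (log_pow_lt_mul_factorial_of_one_lt · hC.add_one)

lemma eventually_mul_log_lt_ceil (C : ℕ) :
    ∀ᶠ n : ℕ in atTop, (C + 1) * Nat.log 2 n < ⌈((C : ℝ) + 2) * Real.logb 2 n⌉₊ := by
  filter_upwards [eventually_ge_atTop 2] with n hn
  have hlog : 0 < Nat.log 2 n := Nat.log_pos one_lt_two hn
  rw [Nat.lt_ceil]
  calc (((C + 1) * Nat.log 2 n : ℕ) : ℝ) < ((C : ℝ) + 2) * Nat.log 2 n := by
        exact_mod_cast Nat.mul_lt_mul_of_pos_right (by lia) hlog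
    _ ≤ ((C : ℝ) + 2) * Real.logb 2 n := by gcongr; exact natCast_le_logb_iff.2 le_rfl

lemma tendsto_pow_mul_of_lt_one_div_pow {β : ℕ → ℝ} {k m : ℕ} (hkm : k < m)
    (hβ : ∀ᶠ n : ℕ in atTop, 0 < β n ∧ β n < 1 / (n : ℝ) ^ m) :
    Tendsto (fun n : ℕ => (n : ℝ) ^ k * β n) atTop (𝓝 0) := by
  refine squeeze_zero' (hβ.mono fun n hn => by have := hn.1; positivity) ?_
    tendsto_one_div_atTop_nhds_zero_nat
  filter_upwards [hβ, eventually_gt_atTop 0] with n hn hn₀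
  have hn₁ : (1 : ℝ) ≤ n := by exact_mod_cast hn₀
  calc (n : ℝ) ^ k * β n ≤ n ^ k * (1 / n ^ (k + 1)) := by
        gcongr
        exact hn.2.le.trans (by gcongr; exact hkm)
    _ = 1 / n := by rw [pow_succ]; field_simp

end Parameters

end Richness

theorem theorem2_general {ε : ℝ} (hε : 0 < ε) {C : ℕ} (hC : Odd C)
    (hlog : Real.log (1 / ε) ^ (C + 1) < ε * (C + 1).factorial) {k : ℕ → ℕ}
    (hk : ∀ᶠ n in Filter.atTop, (C + 1) * Nat.log 2 n < k n) {β : ℕ → ℝ}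
    (hβ : Filter.Tendsto (fun n : ℕ => (n : ℝ) ^ (C + 1) * β n) Filter.atTop (nhds 0))
    {A : Set (List Bool)} (hA : Richness.IsAlmostWiseIndependent k β A) :
    Richness.IsRich ε A ∧ Richness.IsHittingSetForReadOnceDNFCNF ε A :=
  have hrich := hA.isRich hε hC hlog hk hβ
  ⟨hrich, hrich.isHittingSetForReadOnceDNFCNF hε⟩

theorem theorem2 (ε : ℝ) (hε : 0 < ε) (C : ℕ)
    (hC : IsLeast {m : ℕ | Odd m ∧ (2 / ε * Real.log (1 / ε)) ^ 2 < (m : ℝ)} C)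
    (β : ℕ → ℝ) (hβ : ∀ᶠ n : ℕ in Filter.atTop, 0 < β n ∧ β n < 1 / (n : ℝ) ^ (C + 3))
    (A : Set (List Bool))
    (hA : Richness.IsAlmostWiseIndependent
      (fun n => ⌈((C : ℝ) + 2) * Real.logb 2 (n : ℝ)⌉₊) β A) :
    Richness.IsRich ε A ∧ Richness.IsHittingSetForReadOnceDNFCNF ε A :=
  theorem2_general hε hC.1.1 (Richness.log_pow_lt_mul_factorial hε hC.1.1 hC.1.2)
    (Richness.eventually_mul_log_lt_ceil C) (Richness.tendsto_pow_mul_of_lt_one_div_pow (by lia) hβ)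
    hA
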